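/- Let $R$ be a Krull domain whose divisor class group $Cl(R)$ is not a torsion group. Call a height-one prime of $R$ nontorsion if its class in $Cl(R)$ has infinite order. Say that a nonzero nonunit factors uniquely if any two of its factorizations into irreducible elements have the same number of factors and agree up to order and units. Write $I_v=(I^{-1})^{-1}$. Then there exist a nontorsion height-one prime $P$ and an irreducible element $x\in P$ such that $x^2$ factors uniquely. Moreover, $x$ can be chosen so that $(x)=(P_1^{e_1}\cdots P_n^{e_n})_v$, where $P_1,\dots,P_n$ are distinct height-one primes, one of which is $P$, the $e_i$ are positive integers, and the following minimality conditions hold: every nonzero element of $R$ that lies in some nontorsion height-one prime lies in at least $n$ height-one primes; and $(e_1,\dots,e_n)$ is lexicographically least among all $n$-tuples $(f_1,\dots,f_n)$ of positive integers for which $(P_1^{f_1}\cdots P_n^{f_n})_v$ is principal. -/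

import Mathlib

open scoped nonZeroDivisors

namespace KrullFactorization

/-- A prime ideal of height one. -/
structure HeightOnePrime (R : Type*) [CommRing R] where
  asIdeal : Ideal R
  isPrime : asIdeal.IsPrime
  height_eq_one : asIdeal.height = 1

theorem HeightOnePrime.ne_bot {R : Type*} [CommRing R] [IsDomain R] (P : HeightOnePrime R) :
    P.asIdeal ≠ ⊥ := by
  intro h
  have h1 := P.height_eq_one
  rw [h, Ideal.height_bot] at h1
  exact zero_ne_one h1

/-- The localization `R_P`, as a subring of the quotient field of `R`. -/
noncomputable def HeightOnePrime.localSubring {R : Type*} [CommRing R] [IsDomain R]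
    (P : HeightOnePrime R) : Subalgebra R (FractionRing R) :=
  haveI := P.isPrime
  Localization.subalgebra.ofField (FractionRing R) P.asIdeal.primeCompl
    P.asIdeal.primeCompl_le_nonZeroDivisors

/-- Krull domains: `R_P` is a discrete valuation ring for every height-one prime `P`, `R` is the
intersection (inside its quotient field) of these `R_P`, and every nonzero element of `R` lies in
only finitely many height-one primes. Fields are included. -/
class IsKrullDomain (R : Type*) [CommRing R] [IsDomain R] : Prop where
  isDiscreteValuationRing : ∀ P : HeightOnePrime R, IsDiscreteValuationRing P.localSubring
  iInf_localSubring : ⨅ P : HeightOnePrime R, P.localSubring = ⊥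
  finite_heightOnePrime : ∀ x : R, x ≠ 0 → {P : HeightOnePrime R | x ∈ P.asIdeal}.Finite

section VOperation

variable {R : Type*} [CommRing R] [IsDomain R]

/-- The `v`-operation `I ↦ I_v = (I⁻¹)⁻¹` on fractional ideals, `I⁻¹ = (R : I)`. -/
noncomputable def vClosure (I : FractionalIdeal R⁰ (FractionRing R)) :
    FractionalIdeal R⁰ (FractionRing R) := (I⁻¹)⁻¹

theorem fractional_mul_ne_zero {I J : FractionalIdeal R⁰ (FractionRing R)} (hI : I ≠ 0)
    (hJ : J ≠ 0) : I * J ≠ 0 := by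
  obtain ⟨r, hr0, hr⟩ := FractionalIdeal.exists_ne_zero_mem_isInteger hI
  obtain ⟨s, hs0, hs⟩ := FractionalIdeal.exists_ne_zero_mem_isInteger hJ
  intro h
  have hrs := FractionalIdeal.mul_mem_mul hr hs
  rw [h, FractionalIdeal.mem_zero_iff, ← map_mul,
    map_eq_zero_iff _ (IsFractionRing.injective R (FractionRing R))] at hrs
  exact mul_ne_zero hr0 hs0 hrs

theorem inv_ne_zero_of_ne_zero {I : FractionalIdeal R⁰ (FractionRing R)} (hI : I ≠ 0) :
    I⁻¹ ≠ 0 := by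
  intro h
  exact absurd (FractionalIdeal.bot_lt_mul_inv (K := FractionRing R) (I := I) hI) (by simp [h])

theorem le_inv_iff {I J : FractionalIdeal R⁰ (FractionRing R)} (hI : I ≠ 0) :
    J ≤ I⁻¹ ↔ J * I ≤ 1 := by
  rw [FractionalIdeal.inv_eq, FractionalIdeal.le_div_iff_mul_le hI]

theorem le_vClosure (I : FractionalIdeal R⁰ (FractionRing R)) : I ≤ vClosure I := by
  by_cases hI : I = 0
  · simp [hI]
  · rw [vClosure, le_inv_iff (inv_ne_zero_of_ne_zero hI), mul_comm, ← le_inv_iff hI]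

theorem vClosure_ne_zero {I : FractionalIdeal R⁰ (FractionRing R)} (hI : I ≠ 0) :
    vClosure I ≠ 0 :=
  inv_ne_zero_of_ne_zero (inv_ne_zero_of_ne_zero hI)

theorem inv_vClosure {I : FractionalIdeal R⁰ (FractionRing R)} (hI : I ≠ 0) :
    (vClosure I)⁻¹ = I⁻¹ :=
  le_antisymm (FractionalIdeal.inv_anti_mono hI (vClosure_ne_zero hI) (le_vClosure I))
    (le_vClosure I⁻¹)

theorem vClosure_vClosure {I : FractionalIdeal R⁰ (FractionRing R)} (hI : I ≠ 0) :
    vClosure (vClosure I) = vClosure I := by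
  rw [vClosure, inv_vClosure hI, vClosure]

theorem vClosure_spanSingleton (x : FractionRing R) :
    vClosure (FractionalIdeal.spanSingleton R⁰ x) = FractionalIdeal.spanSingleton R⁰ x := by
  simp [vClosure]

theorem vClosure_one : vClosure (1 : FractionalIdeal R⁰ (FractionRing R)) = 1 := by
  rw [← FractionalIdeal.spanSingleton_one, vClosure_spanSingleton]

theorem vClosure_vClosure_mul {I J : FractionalIdeal R⁰ (FractionRing R)} (hI : I ≠ 0)
    (hJ : J ≠ 0) : vClosure (vClosure I * J) = vClosure (I * J) := by
  have h : (vClosure I * J)⁻¹ = (I * J)⁻¹ := by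
    refine eq_of_forall_le_iff fun X => ?_
    rw [le_inv_iff (fractional_mul_ne_zero (vClosure_ne_zero hI) hJ), le_inv_iff (fractional_mul_ne_zero hI hJ),
      mul_comm (vClosure I), mul_comm I, ← mul_assoc, ← mul_assoc, ← le_inv_iff hI,
      ← le_inv_iff (vClosure_ne_zero hI), inv_vClosure hI]
  rw [vClosure, h, vClosure]

/-- In a Krull domain, `(I I⁻¹)_v = R` for every nonzero fractional ideal `I`. -/
theorem vClosure_mul_inv [IsKrullDomain R] {I : FractionalIdeal R⁰ (FractionRing R)}
    (hI : I ≠ 0) : vClosure (I * I⁻¹) = 1 := by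
  have hI' := inv_ne_zero_of_ne_zero hI
  have hone : (1 : FractionalIdeal R⁰ (FractionRing R))⁻¹ = 1 := by
    rw [← FractionalIdeal.spanSingleton_one, FractionalIdeal.spanSingleton_inv, inv_one]
  suffices h : (I * I⁻¹)⁻¹ = 1 by rw [vClosure, h, hone]
  refine le_antisymm ?_ ?_
  · intro x hx
    have hmul : ∀ y ∈ I⁻¹, x * y ∈ I⁻¹ := by
      intro y hy
      rw [FractionalIdeal.mem_inv_iff hI]
      intro z hz
      rw [mul_assoc, mul_comm y z]
      exact (FractionalIdeal.mem_inv_iff (fractional_mul_ne_zero hI hI')).1 hx _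
        (FractionalIdeal.mul_mem_mul hz hy)
    obtain ⟨r, hr0, hr⟩ := FractionalIdeal.exists_ne_zero_mem_isInteger hI
    obtain ⟨s, hs0, hs⟩ := FractionalIdeal.exists_ne_zero_mem_isInteger hI'
    have hpow : ∀ n : ℕ, x ^ n * algebraMap R (FractionRing R) s ∈ I⁻¹ := by
      intro n
      induction n with
      | zero => simpa using hs
      | succ n ih => rw [pow_succ', mul_assoc]; exact hmul _ ih
    have hint : ∀ n : ℕ, ∃ a : R, algebraMap R (FractionRing R) a =
        algebraMap R (FractionRing R) (s * r) * x ^ n := by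
      intro n
      obtain ⟨a, ha⟩ := (FractionalIdeal.mem_one_iff R⁰).1
        ((FractionalIdeal.mem_inv_iff hI).1 (hpow n) _ hr)
      exact ⟨a, by rw [ha, map_mul]; ring⟩
    have hsr : s * r ≠ 0 := mul_ne_zero hs0 hr0
    have hx : x ∈ (⨅ P : HeightOnePrime R, P.localSubring) := by
      rw [Algebra.mem_iInf]
      intro P
      have := IsKrullDomain.isDiscreteValuationRing P
      have hai : IsAlmostIntegral P.localSubring x := by
        refine ⟨algebraMap R P.localSubring (s * r), ?_, fun n => ?_⟩
        · rw [mem_nonZeroDivisors_iff_ne_zero]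
          intro h0
          apply hsr
          have := congrArg (algebraMap P.localSubring (FractionRing R)) h0
          rw [← IsScalarTower.algebraMap_apply, map_zero] at this
          exact (map_eq_zero_iff _ (IsFractionRing.injective R (FractionRing R))).1 this
        · obtain ⟨a, ha⟩ := hint n
          refine ⟨algebraMap R P.localSubring a, ?_⟩
          rw [← IsScalarTower.algebraMap_apply, ha, Algebra.smul_def,
            ← IsScalarTower.algebraMap_apply]
      obtain ⟨y, hy⟩ := IsIntegrallyClosed.isIntegral_iff.1 hai.isIntegral
      rw [← hy]
      exact y.2
    rw [IsKrullDomain.iInf_localSubring, Algebra.mem_bot] at hx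
    obtain ⟨a, rfl⟩ := hx
    exact (FractionalIdeal.mem_one_iff R⁰).2 ⟨a, rfl⟩
  · rw [le_inv_iff (fractional_mul_ne_zero hI hI'), one_mul, mul_comm, ← le_inv_iff hI]

end VOperation

/-- The nonzero divisorial fractional ideals (`v`-ideals) of `R`. -/
@[ext]
structure DivisorialIdeal (R : Type*) [CommRing R] [IsDomain R] where
  val : FractionalIdeal R⁰ (FractionRing R)
  ne_zero : val ≠ 0
  vClosure_eq : vClosure val = val

namespace DivisorialIdeal

variable {R : Type*} [CommRing R] [IsDomain R]

/-- The divisorial ideal `I_v` attached to a nonzero fractional ideal `I`. -/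
noncomputable def ofFractional (I : FractionalIdeal R⁰ (FractionRing R)) (hI : I ≠ 0) :
    DivisorialIdeal R :=
  ⟨vClosure I, vClosure_ne_zero hI, vClosure_vClosure hI⟩

/-- The divisorial ideals of a Krull domain form a group under `v`-multiplication
`I ∘ J = (IJ)_v`, with inverse `I⁻¹ = (R : I)`. -/
noncomputable instance [IsKrullDomain R] : CommGroup (DivisorialIdeal R) where
  mul I J := ofFractional (I.val * J.val) (fractional_mul_ne_zero I.ne_zero J.ne_zero)
  one := ⟨1, one_ne_zero, vClosure_one⟩
  inv I := ⟨I.val⁻¹, inv_ne_zero_of_ne_zero I.ne_zero, inv_vClosure I.ne_zero⟩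
  mul_assoc I J L := by
    apply DivisorialIdeal.ext
    change vClosure (vClosure (I.val * J.val) * L.val) = vClosure (I.val * vClosure (J.val * L.val))
    rw [vClosure_vClosure_mul (fractional_mul_ne_zero I.ne_zero J.ne_zero) L.ne_zero, mul_comm I.val (vClosure _),
      vClosure_vClosure_mul (fractional_mul_ne_zero J.ne_zero L.ne_zero) I.ne_zero, mul_assoc, mul_comm I.val]
  one_mul I := by
    apply DivisorialIdeal.ext
    change vClosure (1 * I.val) = I.val
    rw [one_mul, I.vClosure_eq]
  mul_one I := by
    apply DivisorialIdeal.ext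
    change vClosure (I.val * 1) = I.val
    rw [mul_one, I.vClosure_eq]
  mul_comm I J := by
    apply DivisorialIdeal.ext
    change vClosure (I.val * J.val) = vClosure (J.val * I.val)
    rw [mul_comm]
  inv_mul_cancel I := by
    apply DivisorialIdeal.ext
    change vClosure (I.val⁻¹ * I.val) = 1
    rw [mul_comm, vClosure_mul_inv I.ne_zero]

/-- The subgroup of nonzero principal fractional ideals. -/
noncomputable def principal (R : Type*) [CommRing R] [IsDomain R] [IsKrullDomain R] :
    Subgroup (DivisorialIdeal R) where
  carrier := {I | ∃ x : FractionRing R, I.val = FractionalIdeal.spanSingleton R⁰ x}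
  mul_mem' := by
    rintro I J ⟨x, hx⟩ ⟨y, hy⟩
    refine ⟨x * y, ?_⟩
    change vClosure (I.val * J.val) = _
    rw [hx, hy, FractionalIdeal.spanSingleton_mul_spanSingleton, vClosure_spanSingleton]
  one_mem' := ⟨1, FractionalIdeal.spanSingleton_one.symm⟩
  inv_mem' := by
    rintro I ⟨x, hx⟩
    refine ⟨x⁻¹, ?_⟩
    change I.val⁻¹ = _
    rw [hx, FractionalIdeal.spanSingleton_inv]

end DivisorialIdeal

/-- The (divisor) class group `Cl(R)` of a Krull domain. -/
abbrev DivisorClassGroup (R : Type*) [CommRing R] [IsDomain R] [IsKrullDomain R] : Type _ :=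
  DivisorialIdeal R ⧸ DivisorialIdeal.principal R

/-- The class in `Cl(R)` of a height-one prime `P` (a divisorial ideal, so that `P_v = P`). -/
noncomputable def HeightOnePrime.divisorClass {R : Type*} [CommRing R] [IsDomain R]
    [IsKrullDomain R] (P : HeightOnePrime R) : DivisorClassGroup R :=
  (DivisorialIdeal.ofFractional (P.asIdeal : FractionalIdeal R⁰ (FractionRing R))
    (FractionalIdeal.coeIdeal_ne_zero.2 P.ne_bot) : DivisorialIdeal R)

/-- A nontorsion prime: a height-one prime whose class in `Cl(R)` has infinite order. -/
def HeightOnePrime.IsNontorsion {R : Type*} [CommRing R] [IsDomain R]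
    [IsKrullDomain R] (P : HeightOnePrime R) : Prop :=
  ¬ IsOfFinOrder P.divisorClass

/-- `x` is a nonzero nonunit, and any two factorizations of `x` into irreducibles agree up to
order and units. -/
def FactorsUniquely {R : Type*} [CommRing R] (x : R) : Prop :=
  x ≠ 0 ∧ ¬ IsUnit x ∧ ∀ s t : Multiset R,
    (∀ a ∈ s, Irreducible a) → (∀ b ∈ t, Irreducible b) → s.prod = x → t.prod = x →
      Multiset.Rel Associated s t

/-- `(x) = (P₁^{e₁} ⋯ P_n^{e_n})_v`. -/
def IsVProduct {R : Type*} [CommRing R] [IsDomain R] (x : R) {n : ℕ}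
    (P : Fin n → HeightOnePrime R) (e : Fin n → ℕ) : Prop :=
  vClosure ((∏ i, (P i).asIdeal ^ e i : Ideal R) : FractionalIdeal R⁰ (FractionRing R)) =
    ((Ideal.span {x} : Ideal R) : FractionalIdeal R⁰ (FractionRing R))

/-- `(x) = (P₁^{e₁} ⋯ P_n^{e_n})_v` is a minimal principal `v`-product: the `P_i` are distinct
and the `e_i` positive; `n` is least among the numbers of height-one primes containing `s`, for
nonzero `s` lying in a nontorsion prime; and, for these `P_i` in this order, `e` is
lexicographically least among the tuples of positive exponents whose `v`-product is principal. -/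
structure IsMinimalVProduct {R : Type*} [CommRing R] [IsDomain R] [IsKrullDomain R] (x : R)
    {n : ℕ} (P : Fin n → HeightOnePrime R) (e : Fin n → ℕ) : Prop where
  injective : Function.Injective P
  pos : ∀ i, 0 < e i
  isVProduct : IsVProduct x P e
  card_le : ∀ s : R, s ≠ 0 → (∃ Q : HeightOnePrime R, Q.IsNontorsion ∧ s ∈ Q.asIdeal) →
    n ≤ {Q : HeightOnePrime R | s ∈ Q.asIdeal}.ncard
  lex_le : ∀ f : Fin n → ℕ, (∀ i, 0 < f i) → (∃ y : R, IsVProduct y P f) → toLex e ≤ toLex f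

end KrullFactorization

/-! Elements of a Krull domain are handled through their divisors: up to units, a nonzero element is
its family of orders at the height-one primes, and divisibility is the pointwise order
(`dvd_iff_forall_ord_le`). A `v`-product is determined by its divisor as well, so `isVProduct_iff`
turns the ideal equation for `x` into a statement about orders.

Height-one primes generate the class group, so some prime is nontorsion. Among nonzero elements
lying in a nontorsion prime, take `s` in the fewest height-one primes `Q i`. All the `Q i` are
nontorsion, since a torsion one could be divided out of a power of `s`
(`IsMinimalSupport.isNontorsion`). Let `x` realize the lexicographically least positive exponent
tuple `e` on these primes.

A nonzero element supported on the `Q i` and lying in at least one of them lies in all of them, by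
minimality of their number, so its exponent tuple is lexicographically at least `e`
(`IsMinimalVProduct.lex_le_ord`). A proper factor of `x` would violate this, so `x` is irreducible.
If `x ^ 2 = a * b` with both factors nonunits, two tuples that are at least `e` add up to `e + e`;
both then equal `e`, so `a` and `b` are associated to `x`. -/

namespace KrullFactorization

/-! ### Orders at height-one primes and divisibility. -/

section Order

variable {R : Type*} [CommRing R] [IsDomain R]

instance HeightOnePrime.isLocalization_localSubring (P : HeightOnePrime R) :
    haveI := P.isPrime
    IsLocalization.AtPrime P.localSubring P.asIdeal :=
  haveI := P.isPrime
  Localization.subalgebra.isLocalization_ofField (FractionRing R) P.asIdeal.primeCompl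
    P.asIdeal.primeCompl_le_nonZeroDivisors

theorem HeightOnePrime.ext_of_le {R : Type*} [CommRing R] {P Q : HeightOnePrime R} (h : P.asIdeal ≤ Q.asIdeal) :
    P = Q := by
  have := P.isPrime
  have := Q.isPrime
  suffices h' : P.asIdeal = Q.asIdeal by
    cases P; cases Q; congr
  by_contra hne
  have hlt := Ideal.height_add_one_le_of_lt_of_isPrime (lt_of_le_of_ne h hne)
  rw [P.height_eq_one, Q.height_eq_one] at hlt
  exact absurd hlt (by decide)

theorem HeightOnePrime.exists_mem_notMem {R : Type*} [CommRing R] {P Q : HeightOnePrime R} (h : P ≠ Q) :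
    ∃ x ∈ P.asIdeal, x ∉ Q.asIdeal := by
  by_contra! hle
  exact h (HeightOnePrime.ext_of_le hle)

theorem HeightOnePrime.algebraMap_ne_zero (P : HeightOnePrime R) {x : R} (hx : x ≠ 0) :
    algebraMap R P.localSubring x ≠ 0 := by
  intro h
  have := congrArg (algebraMap P.localSubring (FractionRing R)) h
  rw [← IsScalarTower.algebraMap_apply, map_zero] at this
  exact hx ((map_eq_zero_iff _ (IsFractionRing.injective R (FractionRing R))).1 this)

variable [IsKrullDomain R]

instance (P : HeightOnePrime R) : IsDiscreteValuationRing P.localSubring :=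
  IsKrullDomain.isDiscreteValuationRing P

/-- The order of `x` at `P`, with junk value `0` at `x = 0`. -/
noncomputable def HeightOnePrime.ord (P : HeightOnePrime R) (x : R) : ℕ :=
  (IsDiscreteValuationRing.addVal P.localSubring (algebraMap R P.localSubring x)).toNat

variable (P : HeightOnePrime R) {x y : R}

theorem HeightOnePrime.coe_ord (hx : x ≠ 0) : (P.ord x : ℕ∞) =
    IsDiscreteValuationRing.addVal P.localSubring (algebraMap R P.localSubring x) := by
  apply ENat.natCast_toNat
  rw [Ne, IsDiscreteValuationRing.addVal_eq_top_iff]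
  exact P.algebraMap_ne_zero hx

theorem HeightOnePrime.ord_mul (hx : x ≠ 0) (hy : y ≠ 0) :
    P.ord (x * y) = P.ord x + P.ord y := by
  have : (P.ord (x * y) : ℕ∞) = P.ord x + P.ord y := by
    rw [P.coe_ord hx, P.coe_ord hy, P.coe_ord (mul_ne_zero hx hy), map_mul,
      IsDiscreteValuationRing.addVal_mul]
  exact_mod_cast this

@[simp]
theorem HeightOnePrime.ord_one : P.ord (1 : R) = 0 := by
  have := P.ord_mul (one_ne_zero (α := R)) one_ne_zero
  rw [mul_one] at this
  omega

theorem HeightOnePrime.ord_pow (hx : x ≠ 0) (n : ℕ) : P.ord (x ^ n) = n * P.ord x := by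
  induction n with
  | zero => simp
  | succ n ih => rw [pow_succ, P.ord_mul (pow_ne_zero n hx) hx, ih]; ring

theorem HeightOnePrime.ord_prod {ι : Type*} (s : Finset ι) (f : ι → R) (hf : ∀ i ∈ s, f i ≠ 0) :
    P.ord (∏ i ∈ s, f i) = ∑ i ∈ s, P.ord (f i) := by
  classical
  induction s using Finset.induction_on with
  | empty => simp
  | insert a s ha ih =>
    rw [Finset.forall_mem_insert] at hf
    rw [Finset.prod_insert ha, Finset.sum_insert ha,
      P.ord_mul hf.1 (Finset.prod_ne_zero_iff.2 hf.2), ih hf.2]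

theorem HeightOnePrime.min_ord_le_ord_add (hx : x ≠ 0) (hy : y ≠ 0) (hxy : x + y ≠ 0) :
    min (P.ord x) (P.ord y) ≤ P.ord (x + y) := by
  have h := IsDiscreteValuationRing.addVal_add (R := P.localSubring)
    (a := algebraMap R P.localSubring x) (b := algebraMap R P.localSubring y)
  rw [← map_add, ← P.coe_ord hx, ← P.coe_ord hy, ← P.coe_ord hxy, min_le_iff] at h
  rw [min_le_iff]
  exact_mod_cast h

theorem HeightOnePrime.ord_eq_zero_iff (hx : x ≠ 0) : P.ord x = 0 ↔ x ∉ P.asIdeal := by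
  have := P.isPrime
  have h : (P.ord x : ℕ∞) = 0 ↔ x ∉ P.asIdeal := by
    rw [P.coe_ord hx, IsDiscreteValuationRing.addVal_eq_zero_iff,
      IsLocalization.AtPrime.isUnit_to_map_iff P.localSubring P.asIdeal]
    rfl
  exact_mod_cast h

theorem HeightOnePrime.ord_pos_iff (hx : x ≠ 0) : 0 < P.ord x ↔ x ∈ P.asIdeal := by
  rw [Nat.pos_iff_ne_zero, Ne, P.ord_eq_zero_iff hx, not_not]

/-- A uniformizer of the local ring is a fraction whose denominator lies outside `P`, hence has
order zero; the numerator serves. -/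
theorem HeightOnePrime.exists_ord_eq_one : ∃ p : R, p ≠ 0 ∧ p ∈ P.asIdeal ∧ P.ord p = 1 := by
  have := P.isPrime
  obtain ⟨ϖ, hϖ⟩ := IsDiscreteValuationRing.exists_irreducible P.localSubring
  obtain ⟨⟨a, s⟩, h⟩ := IsLocalization.surj P.asIdeal.primeCompl ϖ
  have hs0 : (s : R) ≠ 0 := fun h0 => s.2 (h0 ▸ P.asIdeal.zero_mem)
  have ha0 : a ≠ 0 := by
    rintro rfl
    rw [map_zero] at h
    exact mul_ne_zero hϖ.ne_zero (P.algebraMap_ne_zero hs0) h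
  have hord : P.ord a = 1 := by
    have h1 : (P.ord a : ℕ∞) = 1 + P.ord s := by
      rw [P.coe_ord ha0, P.coe_ord hs0, ← h, IsDiscreteValuationRing.addVal_mul,
        IsDiscreteValuationRing.addVal_uniformizer hϖ]
    rw [(P.ord_eq_zero_iff hs0).2 s.2] at h1
    exact_mod_cast h1
  exact ⟨a, ha0, (P.ord_pos_iff ha0).1 (by omega), hord⟩

/-- The inequalities put the quotient `y / x` in every `R_P`, and the intersection of these rings is
`R`. -/
theorem dvd_iff_forall_ord_le (hx : x ≠ 0) (hy : y ≠ 0) :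
    x ∣ y ↔ ∀ P : HeightOnePrime R, P.ord x ≤ P.ord y := by
  refine ⟨?_, fun h => ?_⟩
  · rintro ⟨z, rfl⟩ P
    rw [P.ord_mul hx (right_ne_zero_of_mul hy)]
    exact Nat.le_add_right _ _
  · have hx' : algebraMap R (FractionRing R) x ≠ 0 :=
      (map_ne_zero_iff _ (IsFractionRing.injective R (FractionRing R))).2 hx
    have hmem : algebraMap R (FractionRing R) y / algebraMap R (FractionRing R) x ∈
        (⨅ P : HeightOnePrime R, P.localSubring) := by
      rw [Algebra.mem_iInf]
      intro P
      have hP : (P.ord x : ℕ∞) ≤ P.ord y := by exact_mod_cast h P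
      rw [P.coe_ord hx, P.coe_ord hy, IsDiscreteValuationRing.addVal_le_iff_dvd] at hP
      obtain ⟨z, hz⟩ := hP
      have hz' := congrArg (algebraMap P.localSubring (FractionRing R)) hz
      rw [map_mul, ← IsScalarTower.algebraMap_apply, ← IsScalarTower.algebraMap_apply] at hz'
      rw [hz', mul_div_cancel_left₀ _ hx']
      exact z.2
    rw [IsKrullDomain.iInf_localSubring, Algebra.mem_bot] at hmem
    obtain ⟨z, hz⟩ := hmem
    refine ⟨z, IsFractionRing.injective R (FractionRing R) ?_⟩
    rw [map_mul, hz, mul_div_cancel₀ _ hx']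

theorem isUnit_of_forall_ord_eq_zero (hx : x ≠ 0) (h : ∀ P : HeightOnePrime R, P.ord x = 0) :
    IsUnit x := by
  rw [isUnit_iff_dvd_one, dvd_iff_forall_ord_le hx one_ne_zero]
  intro P
  simp [h P]

theorem associated_of_forall_ord_eq (hx : x ≠ 0) (hy : y ≠ 0)
    (h : ∀ P : HeightOnePrime R, P.ord x = P.ord y) : Associated x y :=
  associated_of_dvd_dvd ((dvd_iff_forall_ord_le hx hy).2 fun P => (h P).le)
    ((dvd_iff_forall_ord_le hy hx).2 fun P => (h P).ge)

theorem finite_ord_ne_zero (hx : x ≠ 0) : {P : HeightOnePrime R | P.ord x ≠ 0}.Finite := by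
  refine (IsKrullDomain.finite_heightOnePrime x hx).subset fun P hP => ?_
  exact (P.ord_pos_iff hx).1 (Nat.pos_of_ne_zero hP)

/-- A fraction `a / b` whose only pole is a simple one at `P`. -/
theorem HeightOnePrime.exists_simple_pole : ∃ a b : R, a ≠ 0 ∧ b ≠ 0 ∧
    P.ord b = P.ord a + 1 ∧ ∀ Q : HeightOnePrime R, Q ≠ P → Q.ord b ≤ Q.ord a := by
  classical
  obtain ⟨b, hb0, -, hb1⟩ := P.exists_ord_eq_one
  have hc : ∀ Q : HeightOnePrime R, ∃ c : R, c ≠ 0 ∧ (Q ≠ P → c ∈ Q.asIdeal ∧ c ∉ P.asIdeal) := by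
    intro Q
    by_cases hQ : Q = P
    · exact ⟨1, one_ne_zero, fun h => absurd hQ h⟩
    · obtain ⟨c, hc, hc'⟩ := HeightOnePrime.exists_mem_notMem hQ
      exact ⟨c, fun h => hc' (h ▸ P.asIdeal.zero_mem), fun _ => ⟨hc, hc'⟩⟩
  choose c hc0 hc using hc
  have hterm : ∀ Q ∈ (finite_ord_ne_zero hb0).toFinset.erase P, c Q ^ Q.ord b ≠ 0 :=
    fun Q _ => pow_ne_zero _ (hc0 Q)
  -- Here `b` has a simple zero at `P`. The numerator cancels its zeros at each other `Q` by means
  -- of `c Q`, an element of `Q` outside `P`, and so has order zero at `P`.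
  refine ⟨∏ Q ∈ (finite_ord_ne_zero hb0).toFinset.erase P, c Q ^ Q.ord b, b,
    Finset.prod_ne_zero_iff.2 hterm, hb0, ?_, fun Q hQ => ?_⟩
  · rw [P.ord_prod _ _ hterm, Finset.sum_eq_zero, hb1]
    intro Q hQ
    rw [P.ord_pow (hc0 Q), (P.ord_eq_zero_iff (hc0 Q)).2 (hc Q (Finset.ne_of_mem_erase hQ)).2,
      mul_zero]
  · by_cases hQb : Q.ord b = 0
    · omega
    · rw [Q.ord_prod _ _ hterm]
      refine le_trans ?_ (Finset.single_le_sum (fun _ _ => Nat.zero_le _)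
        (Finset.mem_erase.2 ⟨hQ, (Set.Finite.mem_toFinset _).2 hQb⟩))
      rw [Q.ord_pow (hc0 Q)]
      exact Nat.le_mul_of_pos_right _ ((Q.ord_pos_iff (hc0 Q)).2 (hc Q hQ).1)

end Order

/-! ### Divisors of ideals and the `v`-closure. -/

section Divisor

variable {R : Type*} [CommRing R] [IsDomain R] [IsKrullDomain R]

/-- The elements of order at least `k` at `P`. -/
noncomputable def HeightOnePrime.ordIdeal (P : HeightOnePrime R) (k : ℕ) : Ideal R where
  carrier := {x | x ≠ 0 → k ≤ P.ord x}
  zero_mem' h := absurd rfl h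
  add_mem' {x y} hx hy hxy := by
    by_cases hx0 : x = 0
    · subst hx0
      rw [zero_add] at hxy ⊢
      exact hy hxy
    by_cases hy0 : y = 0
    · subst hy0
      rw [add_zero] at hxy ⊢
      exact hx hxy
    exact (le_min (hx hx0) (hy hy0)).trans (P.min_ord_le_ord_add hx0 hy0 hxy)
  smul_mem' c x hx hcx := by
    rw [smul_eq_mul] at hcx ⊢
    rw [P.ord_mul (left_ne_zero_of_mul hcx) (right_ne_zero_of_mul hcx)]
    exact (hx (right_ne_zero_of_mul hcx)).trans (Nat.le_add_left _ _)

theorem HeightOnePrime.ordIdeal_mul_le (P : HeightOnePrime R) (k l : ℕ) :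
    P.ordIdeal k * P.ordIdeal l ≤ P.ordIdeal (k + l) := by
  rw [Ideal.mul_le]
  intro x hx y hy hxy
  rw [P.ord_mul (left_ne_zero_of_mul hxy) (right_ne_zero_of_mul hxy)]
  exact add_le_add (hx (left_ne_zero_of_mul hxy)) (hy (right_ne_zero_of_mul hxy))

/-- `d` is the divisor of the ideal `I`: `d P` is the least order at `P` of a nonzero element
of `I`. -/
structure HasDivisor (I : Ideal R) (d : HeightOnePrime R → ℕ) : Prop where
  le_ordIdeal : ∀ P : HeightOnePrime R, I ≤ P.ordIdeal (d P)
  exists_ord_eq : ∀ P : HeightOnePrime R, ∃ x ∈ I, x ≠ 0 ∧ P.ord x = d P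

theorem HasDivisor.mul {I J : Ideal R} {d d' : HeightOnePrime R → ℕ} (hI : HasDivisor I d)
    (hJ : HasDivisor J d') : HasDivisor (I * J) (d + d') where
  le_ordIdeal P := (Ideal.mul_mono (hI.le_ordIdeal P) (hJ.le_ordIdeal P)).trans
    (P.ordIdeal_mul_le _ _)
  exists_ord_eq P := by
    obtain ⟨x, hx, hx0, hxd⟩ := hI.exists_ord_eq P
    obtain ⟨y, hy, hy0, hyd⟩ := hJ.exists_ord_eq P
    exact ⟨x * y, Ideal.mul_mem_mul hx hy, mul_ne_zero hx0 hy0, by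
      rw [P.ord_mul hx0 hy0, hxd, hyd, Pi.add_apply]⟩

theorem hasDivisor_span_singleton {x : R} (hx : x ≠ 0) :
    HasDivisor (Ideal.span {x}) fun P => P.ord x where
  le_ordIdeal P := by
    rw [Ideal.span_singleton_le_iff_mem]
    exact fun _ => le_rfl
  exists_ord_eq P := ⟨x, Ideal.mem_span_singleton_self x, hx, rfl⟩

theorem hasDivisor_one : HasDivisor (1 : Ideal R) 0 where
  le_ordIdeal P := fun _ _ _ => Nat.zero_le _
  exists_ord_eq P := ⟨1, by simp, one_ne_zero, P.ord_one⟩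

theorem HasDivisor.pow {I : Ideal R} {d : HeightOnePrime R → ℕ} (hI : HasDivisor I d) (n : ℕ) :
    HasDivisor (I ^ n) (n • d) := by
  induction n with
  | zero => simpa using hasDivisor_one
  | succ n ih => rw [pow_succ, succ_nsmul]; exact ih.mul hI

theorem HasDivisor.prod {ι : Type*} (s : Finset ι) {I : ι → Ideal R}
    {d : ι → HeightOnePrime R → ℕ} (h : ∀ i ∈ s, HasDivisor (I i) (d i)) :
    HasDivisor (∏ i ∈ s, I i) (∑ i ∈ s, d i) := by
  classical
  induction s using Finset.induction_on with
  | empty => simpa using hasDivisor_one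
  | insert a s ha ih =>
    rw [Finset.forall_mem_insert] at h
    rw [Finset.prod_insert ha, Finset.sum_insert ha]
    exact h.1.mul (ih h.2)

open Classical in
theorem HeightOnePrime.hasDivisor (P : HeightOnePrime R) :
    HasDivisor P.asIdeal (Pi.single P 1) where
  le_ordIdeal Q x hx hx0 := by
    by_cases h : Q = P
    · subst h
      rw [Pi.single_eq_same]
      exact (Q.ord_pos_iff hx0).2 hx
    · rw [Pi.single_eq_of_ne h]
      exact Nat.zero_le _
  exists_ord_eq Q := by
    by_cases h : Q = P
    · subst h
      obtain ⟨x, hx0, hx, hx1⟩ := Q.exists_ord_eq_one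
      exact ⟨x, hx, hx0, by rw [hx1, Pi.single_eq_same]⟩
    · obtain ⟨x, hx, hxQ⟩ := HeightOnePrime.exists_mem_notMem (Ne.symm h)
      have hx0 : x ≠ 0 := fun h0 => hxQ (h0 ▸ Q.asIdeal.zero_mem)
      exact ⟨x, hx, hx0, by rw [(Q.ord_eq_zero_iff hx0).2 hxQ, Pi.single_eq_of_ne h]⟩

/-- Any fixed nonzero element of `I` bounds the minimal orders, which makes the support finite. -/
theorem exists_hasDivisor {I : Ideal R} (hI : I ≠ ⊥) :
    ∃ d, HasDivisor I d ∧ {P | d P ≠ 0}.Finite := by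
  obtain ⟨r, hr, hr0⟩ := Submodule.exists_mem_ne_zero_of_ne_bot hI
  have hex : ∀ P : HeightOnePrime R, ∃ x, (x ∈ I ∧ x ≠ 0) ∧
      ∀ y, y ∈ I ∧ y ≠ 0 → P.ord x ≤ P.ord y := by
    intro P
    obtain ⟨x, hx, hmin⟩ := exists_minimalFor_of_wellFoundedLT (fun y => y ∈ I ∧ y ≠ 0) P.ord
      ⟨r, hr, hr0⟩
    exact ⟨x, hx, fun y hy => (le_total _ _).elim id fun h => hmin hy h⟩
  choose x hx hmin using hex
  refine ⟨fun P => P.ord (x P), ⟨fun P y hy hy0 => hmin P y ⟨hy, hy0⟩,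
    fun P => ⟨x P, (hx P).1, (hx P).2, rfl⟩⟩, ?_⟩
  refine (finite_ord_ne_zero hr0).subset fun P hP => ?_
  have := hmin P r ⟨hr, hr0⟩
  simp only [Set.mem_ofPred_eq] at hP ⊢
  omega

/-- The argument `P` matters: without height-one primes, `HasDivisor ⊥ d` holds vacuously. -/
theorem HasDivisor.ne_bot {I : Ideal R} {d : HeightOnePrime R → ℕ} (h : HasDivisor I d)
    (P : HeightOnePrime R) : I ≠ ⊥ := by
  obtain ⟨x, hx, hx0, -⟩ := h.exists_ord_eq P
  exact Submodule.ne_bot_iff _ |>.2 ⟨x, hx, hx0⟩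

/-- Membership means that `b` divides `a * x` for all `x ∈ I`. This is tested prime by prime, the
decisive `x` being one of least order. Thus `I⁻¹`, and with it the `v`-closure, depends only on the
divisor. -/
theorem HasDivisor.div_mem_inv_iff {I : Ideal R} {d : HeightOnePrime R → ℕ}
    (h : HasDivisor I d) (hI : I ≠ ⊥) {a b : R} (ha : a ≠ 0) (hb : b ≠ 0) :
    algebraMap R (FractionRing R) a / algebraMap R (FractionRing R) b ∈
      (I : FractionalIdeal R⁰ (FractionRing R))⁻¹ ↔
    ∀ P : HeightOnePrime R, P.ord b ≤ P.ord a + d P := by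
  have hb' : algebraMap R (FractionRing R) b ≠ 0 :=
    (map_ne_zero_iff _ (IsFractionRing.injective R (FractionRing R))).2 hb
  have hdvd : algebraMap R (FractionRing R) a / algebraMap R (FractionRing R) b ∈
      (I : FractionalIdeal R⁰ (FractionRing R))⁻¹ ↔ ∀ x ∈ I, b ∣ a * x := by
    rw [FractionalIdeal.mem_inv_iff (FractionalIdeal.coeIdeal_ne_zero.2 hI)]
    constructor
    · intro H x hx
      obtain ⟨z, hz⟩ := (FractionalIdeal.mem_one_iff R⁰).1
        (H _ (FractionalIdeal.mem_coeIdeal_of_mem R⁰ hx))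
      refine ⟨z, IsFractionRing.injective R (FractionRing R) ?_⟩
      rw [map_mul, map_mul, hz]
      field_simp
    · intro H y hy
      obtain ⟨x, hx, rfl⟩ := (FractionalIdeal.mem_coeIdeal R⁰).1 hy
      obtain ⟨z, hz⟩ := H x hx
      refine (FractionalIdeal.mem_one_iff R⁰).2 ⟨z, ?_⟩
      have := congrArg (algebraMap R (FractionRing R)) hz
      rw [map_mul, map_mul] at this
      rw [div_mul_eq_mul_div, this, mul_div_cancel_left₀ _ hb']
  rw [hdvd]
  constructor
  · intro H P
    obtain ⟨x, hx, hx0, hxd⟩ := h.exists_ord_eq P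
    rw [← hxd, ← P.ord_mul ha hx0]
    exact (dvd_iff_forall_ord_le hb (mul_ne_zero ha hx0)).1 (H x hx) P
  · intro H x hx
    by_cases hx0 : x = 0
    · simp [hx0]
    · rw [dvd_iff_forall_ord_le hb (mul_ne_zero ha hx0)]
      intro P
      rw [P.ord_mul ha hx0]
      exact (H P).trans (Nat.add_le_add_left (h.le_ordIdeal P hx hx0) _)

theorem HasDivisor.vClosure_eq {I J : Ideal R} {d : HeightOnePrime R → ℕ} (hI : HasDivisor I d)
    (hJ : HasDivisor J d) (hI0 : I ≠ ⊥) (hJ0 : J ≠ ⊥) :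
    vClosure (I : FractionalIdeal R⁰ (FractionRing R)) = vClosure J := by
  suffices h : (I : FractionalIdeal R⁰ (FractionRing R))⁻¹ = (J : FractionalIdeal _ _)⁻¹ by
    rw [vClosure, h, vClosure]
  ext t
  obtain ⟨a, b, hb, rfl⟩ := IsFractionRing.div_surjective (A := R) t
  by_cases ha : a = 0
  · simp [ha, FractionalIdeal.zero_mem]
  · have hb := nonZeroDivisors.ne_zero hb
    rw [hI.div_mem_inv_iff hI0 ha hb, hJ.div_mem_inv_iff hJ0 ha hb]

/-- The power `(a / b) ^ d P` of a fraction with a simple pole at `P` alone lies in `I⁻¹`. Its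
membership in `J⁻¹` bounds `d P` by `d' P`. -/
theorem HasDivisor.le_of_inv_le {I J : Ideal R} {d d' : HeightOnePrime R → ℕ}
    (hI : HasDivisor I d) (hJ : HasDivisor J d')
    (h : (I : FractionalIdeal R⁰ (FractionRing R))⁻¹ ≤ (J : FractionalIdeal _ _)⁻¹) :
    d ≤ d' := by
  intro P
  obtain ⟨a, b, ha, hb, hP, hQ⟩ := P.exists_simple_pole
  have hak := pow_ne_zero (d P) ha
  have hbk := pow_ne_zero (d P) hb
  have hmem := (hI.div_mem_inv_iff (hI.ne_bot P) hak hbk).2 fun Q => by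
    rw [Q.ord_pow ha, Q.ord_pow hb]
    by_cases hQP : Q = P
    · subst hQP
      rw [hP]
      exact (mul_add_one _ _).le
    · exact (Nat.mul_le_mul_left _ (hQ Q hQP)).trans (Nat.le_add_right _ _)
  have := (hJ.div_mem_inv_iff (hJ.ne_bot P) hak hbk).1 (h hmem) P
  rw [P.ord_pow ha, P.ord_pow hb, hP, mul_add_one] at this
  exact Nat.le_of_add_le_add_left this

theorem HasDivisor.eq_of_vClosure_eq {I J : Ideal R} {d d' : HeightOnePrime R → ℕ}
    (hI : HasDivisor I d) (hJ : HasDivisor J d')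
    (h : vClosure (I : FractionalIdeal R⁰ (FractionRing R)) = vClosure J) : d = d' := by
  funext P
  have hinv : (I : FractionalIdeal R⁰ (FractionRing R))⁻¹ = (J : FractionalIdeal _ _)⁻¹ := by
    rw [← inv_vClosure (FractionalIdeal.coeIdeal_ne_zero.2 (hI.ne_bot P)), h,
      inv_vClosure (FractionalIdeal.coeIdeal_ne_zero.2 (hJ.ne_bot P))]
  exact le_antisymm (hI.le_of_inv_le hJ hinv.le P) (hJ.le_of_inv_le hI hinv.ge P)

open Classical in
/-- `(x) = (∏ Pᵢ^{eᵢ})_v` says that the divisor of `x` is `∑ eᵢ Pᵢ`. -/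
theorem isVProduct_iff {x : R} {n : ℕ} {P : Fin n → HeightOnePrime R} {e : Fin n → ℕ} :
    IsVProduct x P e ↔
      x ≠ 0 ∧ ∀ Q : HeightOnePrime R, Q.ord x = ∑ i, e i * if Q = P i then 1 else 0 := by
  have hdiv := HasDivisor.prod Finset.univ fun i _ => (P i).hasDivisor.pow (e i)
  have hne : (∏ i, (P i).asIdeal ^ e i : Ideal R) ≠ ⊥ :=
    Finset.prod_ne_zero_iff.2 fun i _ => pow_ne_zero _ (P i).ne_bot
  have hspan : ((Ideal.span {x} : Ideal R) : FractionalIdeal R⁰ (FractionRing R)) =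
      vClosure ((Ideal.span {x} : Ideal R) : FractionalIdeal R⁰ (FractionRing R)) := by
    rw [FractionalIdeal.coeIdeal_span_singleton, vClosure_spanSingleton]
  have hd : ∀ Q, (∑ i, e i • (Pi.single (P i) 1 : HeightOnePrime R → ℕ)) Q =
      ∑ i, e i * if Q = P i then 1 else 0 := by
    intro Q
    simp [Finset.sum_apply, Pi.single_apply]
  unfold IsVProduct
  constructor
  · intro h
    have hx : x ≠ 0 := by
      rintro rfl
      refine vClosure_ne_zero (FractionalIdeal.coeIdeal_ne_zero.2 hne) ?_
      rw [h]
      simp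
    refine ⟨hx, fun Q => ?_⟩
    rw [← hd, hdiv.eq_of_vClosure_eq (hasDivisor_span_singleton hx) (h.trans hspan)]
  · rintro ⟨hx, h⟩
    rw [hspan]
    refine hdiv.vClosure_eq ?_ hne (by simpa using hx)
    convert hasDivisor_span_singleton hx using 1
    funext Q
    rw [hd, h]

end Divisor

/-! ### Generators of the class group and nontorsion primes. -/

section ClassGroup

variable {R : Type*} [CommRing R] [IsDomain R] [IsKrullDomain R]

/-- The class in `Cl(R)` of a nonzero fractional ideal. -/
noncomputable def fractionalClass (I : FractionalIdeal R⁰ (FractionRing R)) (hI : I ≠ 0) :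
    DivisorClassGroup R :=
  (DivisorialIdeal.ofFractional I hI : DivisorialIdeal R)

theorem fractionalClass_mul {I J : FractionalIdeal R⁰ (FractionRing R)} (hI : I ≠ 0)
    (hJ : J ≠ 0) : fractionalClass (I * J) (fractional_mul_ne_zero hI hJ) =
      fractionalClass I hI * fractionalClass J hJ := by
  refine congrArg (QuotientGroup.mk (s := DivisorialIdeal.principal R))
    (DivisorialIdeal.ext ?_)
  change vClosure (I * J) = vClosure (vClosure I * vClosure J)
  rw [vClosure_vClosure_mul hI (vClosure_ne_zero hJ), mul_comm I (vClosure J), vClosure_vClosure_mul hJ hI,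
    mul_comm]

theorem fractionalClass_spanSingleton {x : FractionRing R}
    (hx : FractionalIdeal.spanSingleton R⁰ x ≠ 0) :
    fractionalClass (FractionalIdeal.spanSingleton R⁰ x) hx = 1 :=
  (QuotientGroup.eq_one_iff _).2 ⟨x, vClosure_spanSingleton x⟩

theorem fractionalClass_one :
    fractionalClass (1 : FractionalIdeal R⁰ (FractionRing R)) one_ne_zero = 1 :=
  (QuotientGroup.eq_one_iff _).2 ⟨1, by
    rw [FractionalIdeal.spanSingleton_one]; exact vClosure_one⟩

theorem fractionalClass_congr {I J : FractionalIdeal R⁰ (FractionRing R)} (hI : I ≠ 0)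
    (hJ : J ≠ 0) (h : vClosure I = vClosure J) : fractionalClass I hI = fractionalClass J hJ :=
  congrArg (QuotientGroup.mk (s := DivisorialIdeal.principal R)) (DivisorialIdeal.ext h)

theorem HeightOnePrime.divisorClass_pow (P : HeightOnePrime R) (n : ℕ) :
    P.divisorClass ^ n =
      fractionalClass ((P.asIdeal ^ n : Ideal R) : FractionalIdeal R⁰ (FractionRing R))
        (FractionalIdeal.coeIdeal_ne_zero.2 (pow_ne_zero n P.ne_bot)) := by
  induction n with
  | zero =>
    rw [pow_zero, ← fractionalClass_one]
    exact fractionalClass_congr _ _ (by simp)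
  | succ n ih =>
    rw [pow_succ, ih, HeightOnePrime.divisorClass, ← fractionalClass, ← fractionalClass_mul]
    exact fractionalClass_congr _ _ (by rw [pow_succ, FractionalIdeal.coeIdeal_mul])

/-- Nonvanishing is carried through the induction together with membership because `fractionalClass`
takes it as an argument. -/
theorem fractionalClass_prod_mem {G : Subgroup (DivisorClassGroup R)} {ι : Type*} (s : Finset ι)
    (I : ι → Ideal R) (hI : ∀ i ∈ s, ∃ h : (I i : FractionalIdeal R⁰ (FractionRing R)) ≠ 0,
      fractionalClass (I i : FractionalIdeal R⁰ (FractionRing R)) h ∈ G) :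
    ∃ h : ((∏ i ∈ s, I i : Ideal R) : FractionalIdeal R⁰ (FractionRing R)) ≠ 0,
      fractionalClass ((∏ i ∈ s, I i : Ideal R) : FractionalIdeal R⁰ (FractionRing R)) h ∈ G := by
  classical
  induction s using Finset.induction_on with
  | empty =>
    have h : ((∏ i ∈ ∅, I i : Ideal R) : FractionalIdeal R⁰ (FractionRing R)) = 1 := by
      rw [Finset.prod_empty, Ideal.one_eq_top, FractionalIdeal.coeIdeal_top]
    have h1 : (1 : FractionalIdeal R⁰ (FractionRing R)) ≠ 0 := one_ne_zero
    refine ⟨h ▸ h1, ?_⟩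
    rw [fractionalClass_congr (h ▸ h1) h1 (congrArg vClosure h), fractionalClass_one]
    exact G.one_mem
  | insert a s ha ih =>
    rw [Finset.forall_mem_insert] at hI
    obtain ⟨h1, hG1⟩ := hI.1
    obtain ⟨h2, hG2⟩ := ih hI.2
    refine ⟨?_, ?_⟩
    · rw [Finset.prod_insert ha, FractionalIdeal.coeIdeal_mul]
      exact fractional_mul_ne_zero h1 h2
    · rw [fractionalClass_congr _ (fractional_mul_ne_zero h1 h2)
        (by rw [Finset.prod_insert ha, FractionalIdeal.coeIdeal_mul]), fractionalClass_mul h1 h2]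
      exact G.mul_mem hG1 hG2

/-- The class group is generated by the classes of the height-one primes. -/
theorem closure_range_divisorClass :
    Subgroup.closure (Set.range (HeightOnePrime.divisorClass (R := R))) = ⊤ := by
  classical
  rw [eq_top_iff]
  intro g _
  obtain ⟨I, rfl⟩ := QuotientGroup.mk_surjective g
  -- Clearing denominators changes `I` by a principal factor, so an integral ideal `J` represents
  -- the class.
  obtain ⟨a, J, ha, hJ⟩ := FractionalIdeal.exists_eq_spanSingleton_mul I.val
  have hJ0 : (J : FractionalIdeal R⁰ (FractionRing R)) ≠ 0 := by
    intro h
    exact I.ne_zero (by rw [hJ, h, mul_zero])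
  have ha0 : FractionalIdeal.spanSingleton R⁰ (algebraMap R (FractionRing R) a)⁻¹ ≠ 0 := by
    intro h
    exact I.ne_zero (by rw [hJ, h, zero_mul])
  have hIJ : (QuotientGroup.mk I : DivisorClassGroup R) = fractionalClass J hJ0 := by
    rw [← one_mul (fractionalClass _ hJ0), ← fractionalClass_spanSingleton ha0,
      ← fractionalClass_mul]
    refine congrArg (QuotientGroup.mk (s := DivisorialIdeal.principal R))
      (DivisorialIdeal.ext ?_)
    change I.val = vClosure _
    rw [← hJ, I.vClosure_eq]
  rw [hIJ]
  -- `J` has the same divisor, hence the same `v`-closure, as the finite product of the `P ^ d P`.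
  obtain ⟨d, hd, hfin⟩ := exists_hasDivisor (FractionalIdeal.coeIdeal_ne_zero.1 hJ0)
  obtain ⟨h0, hmem⟩ := fractionalClass_prod_mem
    (G := Subgroup.closure (Set.range (HeightOnePrime.divisorClass (R := R)))) hfin.toFinset
    (fun P => P.asIdeal ^ d P) fun P _ => ⟨FractionalIdeal.coeIdeal_ne_zero.2
      (pow_ne_zero _ P.ne_bot), by
      rw [← P.divisorClass_pow]
      exact Subgroup.pow_mem _ (Subgroup.subset_closure (Set.mem_range_self P)) _⟩
  rw [fractionalClass_congr hJ0 h0]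
  · exact hmem
  refine hd.vClosure_eq ?_ (FractionalIdeal.coeIdeal_ne_zero.1 hJ0)
    (FractionalIdeal.coeIdeal_ne_zero.1 h0)
  convert HasDivisor.prod hfin.toFinset fun P _ => P.hasDivisor.pow (d P) using 1
  funext Q
  simp only [Finset.sum_apply, Pi.smul_apply, Pi.single_apply, smul_eq_mul, mul_ite, mul_one,
    mul_zero, Finset.sum_ite_eq, Set.Finite.mem_toFinset, Set.mem_ofPred_eq]
  split_ifs with h
  · rfl
  · exact not_not.1 h

/-- The torsion elements of an abelian group form a subgroup; if it contained all the generators, it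
would be everything. -/
theorem exists_isNontorsion (hR : ¬ IsMulTorsion (DivisorClassGroup R)) :
    ∃ P : HeightOnePrime R, P.IsNontorsion := by
  by_contra! h
  refine hR fun g => ?_
  have hle : Subgroup.closure (Set.range (HeightOnePrime.divisorClass (R := R))) ≤
      CommGroup.torsion (DivisorClassGroup R) := by
    rw [Subgroup.closure_le]
    rintro _ ⟨P, rfl⟩
    exact not_not.1 (h P)
  rw [closure_range_divisorClass] at hle
  exact hle (Subgroup.mem_top g)

/-- If the class of `P` is torsion then some multiple of the divisor `P` is principal. -/
theorem HeightOnePrime.exists_ord_of_not_isNontorsion {P : HeightOnePrime R}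
    (h : ¬ P.IsNontorsion) : ∃ c : R, c ≠ 0 ∧ 0 < P.ord c ∧
      ∀ Q : HeightOnePrime R, Q ≠ P → Q.ord c = 0 := by
  classical
  obtain ⟨m, hm, hpow⟩ := isOfFinOrder_iff_pow_eq_one.1 (not_not.1 h)
  rw [P.divisorClass_pow] at hpow
  obtain ⟨t, ht⟩ := (QuotientGroup.eq_one_iff _).1 hpow
  change vClosure _ = _ at ht
  have hne : (P.asIdeal ^ m : Ideal R) ≠ ⊥ := pow_ne_zero m P.ne_bot
  have hne' := (FractionalIdeal.coeIdeal_ne_zero (K := FractionRing R)).2 hne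
  -- The `v`-closure of an integral ideal is integral, so the generator `t` comes from an element of
  -- `R`.
  have hle : vClosure ((P.asIdeal ^ m : Ideal R) : FractionalIdeal R⁰ (FractionRing R)) ≤ 1 := by
    rw [← vClosure_one]
    exact FractionalIdeal.inv_anti_mono (inv_ne_zero_of_ne_zero one_ne_zero)
      (inv_ne_zero_of_ne_zero hne')
      (FractionalIdeal.inv_anti_mono hne' one_ne_zero FractionalIdeal.coeIdeal_le_one)
  rw [ht] at hle
  obtain ⟨c, rfl⟩ := (FractionalIdeal.mem_one_iff R⁰).1
    (hle (FractionalIdeal.mem_spanSingleton_self R⁰ t))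
  have hc : c ≠ 0 := by
    rintro rfl
    exact vClosure_ne_zero hne' (by rw [ht]; simp)
  have hdiv := (P.hasDivisor.pow m).eq_of_vClosure_eq (hasDivisor_span_singleton hc) (by
    rw [ht, FractionalIdeal.coeIdeal_span_singleton, vClosure_spanSingleton])
  refine ⟨c, hc, ?_, fun Q hQ => ?_⟩
  · have := congrFun hdiv P
    simp only [Pi.smul_apply, Pi.single_eq_same, smul_eq_mul, mul_one] at this
    omega
  · have := congrFun hdiv Q
    simpa [Pi.single_eq_of_ne hQ] using this.symm

end ClassGroup

theorem exists_eq_singleton_of_irreducible_prod {M : Type*} [CommMonoid M] {s : Multiset M}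
    (hs : ∀ a ∈ s, Irreducible a) (h : Irreducible s.prod) : ∃ a, s = {a} := by
  rcases s.empty_or_exists_mem with rfl | ⟨a, ha⟩
  · exact absurd (Multiset.prod_zero (M := M)) h.ne_one
  obtain ⟨t, rfl⟩ := Multiset.exists_cons_of_mem ha
  rw [Multiset.prod_cons] at h
  have ht := (h.isUnit_or_isUnit rfl).resolve_left (hs a ha).not_isUnit
  rcases t.empty_or_exists_mem with rfl | ⟨b, hb⟩
  · exact ⟨a, rfl⟩
  · exact absurd (isUnit_of_dvd_unit (Multiset.dvd_prod hb) ht)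
      (hs b (Multiset.mem_cons_of_mem hb)).not_isUnit

/-! ### Minimal supports and lexicographically least exponents. -/

variable {R : Type*} [CommRing R] [IsDomain R] [IsKrullDomain R]

/-- `s` lies in a nontorsion prime and, among all such nonzero elements, it lies in the fewest
height-one primes. -/
structure IsMinimalSupport (s : R) : Prop where
  ne_zero : s ≠ 0
  exists_mem : ∃ Q : HeightOnePrime R, Q.IsNontorsion ∧ s ∈ Q.asIdeal
  ncard_le : ∀ t : R, t ≠ 0 → (∃ Q : HeightOnePrime R, Q.IsNontorsion ∧ t ∈ Q.asIdeal) →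
    {Q : HeightOnePrime R | s ∈ Q.asIdeal}.ncard ≤ {Q : HeightOnePrime R | t ∈ Q.asIdeal}.ncard

theorem exists_isMinimalSupport (hR : ¬ IsMulTorsion (DivisorClassGroup R)) :
    ∃ s : R, IsMinimalSupport s := by
  obtain ⟨P, hP⟩ := exists_isNontorsion hR
  obtain ⟨p, hp0, hp, -⟩ := P.exists_ord_eq_one
  obtain ⟨s, hs, hmin⟩ := exists_minimalFor_of_wellFoundedLT
    (fun t : R => t ≠ 0 ∧ ∃ Q : HeightOnePrime R, Q.IsNontorsion ∧ t ∈ Q.asIdeal)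
    (fun t => {Q : HeightOnePrime R | t ∈ Q.asIdeal}.ncard) ⟨p, hp0, P, hP, hp⟩
  exact ⟨s, hs.1, hs.2, fun t ht0 ht => (le_total _ _).elim id fun h => hmin ⟨ht0, ht⟩ h⟩

/-- The support of `s` is finite and of least size, so a competing support contained in it is equal
to it. -/
theorem IsMinimalSupport.mem_of_subset {s : R} (hs : IsMinimalSupport s) {t : R} (ht : t ≠ 0)
    (hsub : ∀ Q : HeightOnePrime R, t ∈ Q.asIdeal → s ∈ Q.asIdeal)
    (hnt : ∃ Q : HeightOnePrime R, Q.IsNontorsion ∧ t ∈ Q.asIdeal) {Q : HeightOnePrime R}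
    (hQ : s ∈ Q.asIdeal) : t ∈ Q.asIdeal := by
  have heq : {Q : HeightOnePrime R | t ∈ Q.asIdeal} = {Q : HeightOnePrime R | s ∈ Q.asIdeal} :=
    Set.eq_of_subset_of_ncard_le (fun Q hQ => hsub Q hQ) (hs.ncard_le t ht hnt)
      (IsKrullDomain.finite_heightOnePrime s hs.ne_zero)
  exact heq.ge hQ

/-- If `T` were torsion, some `c` would vanish at `T` only. Dividing a power of `s` by a power of
`c` removes `T` from the support and keeps every nontorsion prime, contradicting minimality. -/
theorem IsMinimalSupport.isNontorsion {s : R} (hs : IsMinimalSupport s) {T : HeightOnePrime R}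
    (hT : s ∈ T.asIdeal) : T.IsNontorsion := by
  by_contra hnt
  obtain ⟨c, hc0, hcT, hc⟩ := HeightOnePrime.exists_ord_of_not_isNontorsion hnt
  have hs0 := hs.ne_zero
  -- The exponents are chosen so that both sides have the same order at `T`; the quotient `z` then
  -- has order zero there.
  obtain ⟨z, hz⟩ : c ^ T.ord s ∣ s ^ T.ord c := by
    rw [dvd_iff_forall_ord_le (pow_ne_zero _ hc0) (pow_ne_zero _ hs0)]
    intro Q
    rw [Q.ord_pow hc0, Q.ord_pow hs0]
    by_cases hQ : Q = T
    · rw [hQ, mul_comm]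
    · rw [hc Q hQ, mul_zero]
      exact Nat.zero_le _
  have hz0 : z ≠ 0 := right_ne_zero_of_mul (hz ▸ pow_ne_zero _ hs0)
  have hord : ∀ Q : HeightOnePrime R, T.ord c * Q.ord s = T.ord s * Q.ord c + Q.ord z := by
    intro Q
    rw [← Q.ord_pow hs0, hz, Q.ord_mul (pow_ne_zero _ hc0) hz0, Q.ord_pow hc0]
  have hzT : z ∉ T.asIdeal := by
    rw [← T.ord_eq_zero_iff hz0]
    have := hord T
    rw [mul_comm] at this
    omega
  refine hzT (hs.mem_of_subset hz0 (fun Q hQ => ?_) ?_ hT)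
  · rw [← Q.ord_pos_iff hz0] at hQ
    rw [← Q.ord_pos_iff hs0]
    have := hord Q
    exact Nat.pos_of_mul_pos_left (a := T.ord c) (by omega)
  · obtain ⟨Q, hQ, hsQ⟩ := hs.exists_mem
    refine ⟨Q, hQ, ?_⟩
    rw [← Q.ord_pos_iff hs0] at hsQ
    have := hord Q
    rw [hc Q (fun h => hnt (h ▸ hQ)), mul_zero, zero_add] at this
    rw [← Q.ord_pos_iff hz0, ← this]
    exact Nat.mul_pos hcT hsQ

theorem isVProduct_iff_of_injective {x : R} {n : ℕ} {P : Fin n → HeightOnePrime R}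
    (hP : Function.Injective P) {e : Fin n → ℕ} :
    IsVProduct x P e ↔ x ≠ 0 ∧ (∀ i, (P i).ord x = e i) ∧
      ∀ Q : HeightOnePrime R, (∀ i, P i ≠ Q) → Q.ord x = 0 := by
  classical
  rw [isVProduct_iff]
  refine and_congr_right fun _ => ⟨fun h => ⟨fun i => ?_, fun Q hQ => ?_⟩, fun h Q => ?_⟩
  · simp [h, hP.eq_iff]
  · rw [h]
    exact Finset.sum_eq_zero fun i _ => by rw [if_neg (hQ i).symm, mul_zero]
  · by_cases hQ : ∃ i, P i = Q
    · obtain ⟨i, rfl⟩ := hQ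
      simp [h.1, hP.eq_iff]
    · push Not at hQ
      rw [h.2 Q hQ]
      exact (Finset.sum_eq_zero fun i _ => by rw [if_neg (hQ i).symm, mul_zero]).symm

/-- A minimal principal `v`-product all of whose primes are nontorsion. -/
theorem exists_isMinimalVProduct (hR : ¬ IsMulTorsion (DivisorClassGroup R)) :
    ∃ (x : R) (n : ℕ) (Q : Fin n → HeightOnePrime R) (e : Fin n → ℕ),
      IsMinimalVProduct x Q e ∧ (∀ i, (Q i).IsNontorsion) ∧ 0 < n := by
  obtain ⟨s, hs⟩ := exists_isMinimalSupport hR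
  have hs0 := hs.ne_zero
  have hfin := IsKrullDomain.finite_heightOnePrime s hs0
  have := hfin.to_subtype
  let φ := Finite.equivFinOfCardEq (Nat.card_coe_set_eq {Q : HeightOnePrime R | s ∈ Q.asIdeal})
  let Q := fun i => (φ.symm i).1
  have hQs : ∀ i, s ∈ (Q i).asIdeal := fun i => (φ.symm i).2
  have hQ : Function.Injective Q := Subtype.val_injective.comp φ.symm.injective
  have hsurj : ∀ P : HeightOnePrime R, s ∈ P.asIdeal → ∃ i, Q i = P := fun P hP =>
    ⟨φ ⟨P, hP⟩, by simp [Q]⟩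
  -- The lexicographic order on tuples of fixed length in `ℕ` is well-founded, and the orders of `s`
  -- itself show that `A` is nonempty. The numbering of the primes is arbitrary.
  let A : Set (Lex (Fin _ → ℕ)) := {e | (∀ i, 0 < ofLex e i) ∧ ∃ y : R, IsVProduct y Q (ofLex e)}
  have hA : A.Nonempty := by
    refine ⟨toLex fun i => (Q i).ord s, fun i => ((Q i).ord_pos_iff hs0).2 (hQs i), s, ?_⟩
    refine (isVProduct_iff_of_injective hQ).2 ⟨hs0, fun i => rfl, fun P hP => ?_⟩
    rw [P.ord_eq_zero_iff hs0]
    intro h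
    obtain ⟨i, hi⟩ := hsurj P h
    exact hP i hi
  obtain ⟨hpos, x, hx⟩ := WellFounded.min_mem wellFounded_lt A hA
  refine ⟨x, _, Q, ofLex (WellFounded.min wellFounded_lt A hA),
    ⟨hQ, hpos, hx, hs.ncard_le, fun f hf hy => ?_⟩, fun i => hs.isNontorsion (hQs i), ?_⟩
  · exact not_lt.1 (WellFounded.not_lt_min wellFounded_lt A (x := toLex f) ⟨hf, hy⟩)
  · obtain ⟨P, -, hP⟩ := hs.exists_mem
    exact Set.ncard_pos hfin |>.2 ⟨P, hP⟩

/-! ### Irreducibility of `x` and unique factorization of its square. -/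

section MinimalVProduct

variable {x : R} {n : ℕ} {Q : Fin n → HeightOnePrime R} {e : Fin n → ℕ}

theorem IsMinimalVProduct.ne_zero (h : IsMinimalVProduct x Q e) : x ≠ 0 :=
  ((isVProduct_iff_of_injective h.injective).1 h.isVProduct).1

theorem IsMinimalVProduct.ord_apply (h : IsMinimalVProduct x Q e) (i : Fin n) :
    (Q i).ord x = e i :=
  ((isVProduct_iff_of_injective h.injective).1 h.isVProduct).2.1 i

theorem IsMinimalVProduct.ord_eq_zero (h : IsMinimalVProduct x Q e) {P : HeightOnePrime R}
    (hP : ∀ i, Q i ≠ P) : P.ord x = 0 :=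
  ((isVProduct_iff_of_injective h.injective).1 h.isVProduct).2.2 P hP

theorem IsMinimalVProduct.mem (h : IsMinimalVProduct x Q e) (i : Fin n) : x ∈ (Q i).asIdeal := by
  rw [← (Q i).ord_pos_iff h.ne_zero, h.ord_apply]
  exact h.pos i

/-- A divisor of a power of `x` lying in some nontorsion `Q i` has a lexicographically larger
exponent tuple than `x`. -/
theorem IsMinimalVProduct.lex_le_ord (h : IsMinimalVProduct x Q e)
    (hnt : ∀ i, (Q i).IsNontorsion) {y : R} (hy : y ≠ 0)
    (hord : ∀ P : HeightOnePrime R, (∀ i, Q i ≠ P) → P.ord y = 0)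
    (hi : ∃ i, y ∈ (Q i).asIdeal) : toLex e ≤ toLex fun i => (Q i).ord y := by
  obtain ⟨i, hi⟩ := hi
  refine h.lex_le _ (fun j => ?_)
    ⟨y, (isVProduct_iff_of_injective h.injective).2 ⟨hy, fun _ => rfl, hord⟩⟩
  rw [(Q j).ord_pos_iff hy]
  -- The support of `y` lies among the `n` primes `Q i` and has at least `n` members by `card_le`,
  -- so it is all of them and every exponent is positive.
  have hsub : {P : HeightOnePrime R | y ∈ P.asIdeal} ⊆ Set.range Q := by
    intro P hP
    by_contra hPQ
    exact (P.ord_eq_zero_iff hy).1 (hord P fun i hi => hPQ ⟨i, hi⟩) hP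
  have hcard : (Set.range Q).ncard = n := by
    rw [← Set.image_univ, Set.ncard_image_of_injective _ h.injective, Set.ncard_univ,
      Nat.card_eq_fintype_card, Fintype.card_fin]
  exact (Set.eq_of_subset_of_ncard_le hsub (hcard.trans_le (h.card_le y hy ⟨Q i, hnt i, hi⟩))
    (Set.finite_range Q)).ge ⟨j, rfl⟩

/-- The exponents of the factor `a` are pointwise at most `e`, yet lexicographically at least `e`.
They agree with `e`, which leaves `b` of order zero everywhere. -/
theorem IsMinimalVProduct.isUnit_of_eq_mul (h : IsMinimalVProduct x Q e)
    (hnt : ∀ i, (Q i).IsNontorsion) {a b : R} (hab : x = a * b) {i : Fin n}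
    (ha : a ∈ (Q i).asIdeal) : IsUnit b := by
  have ha0 : a ≠ 0 := left_ne_zero_of_mul (hab ▸ h.ne_zero)
  have hb0 : b ≠ 0 := right_ne_zero_of_mul (hab ▸ h.ne_zero)
  have hord : ∀ P : HeightOnePrime R, P.ord x = P.ord a + P.ord b := fun P => by
    rw [hab, P.ord_mul ha0 hb0]
  have hle := h.lex_le_ord hnt ha0 (fun P hP => by
    have := h.ord_eq_zero hP
    have := hord P
    omega) ⟨i, ha⟩
  have heq : e = fun i => (Q i).ord a := toLex.injective <| le_antisymm hle <|
    Pi.toLex_monotone fun i => by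
      have := h.ord_apply i
      have := hord (Q i)
      omega
  refine isUnit_of_forall_ord_eq_zero hb0 fun P => ?_
  have hP := hord P
  by_cases hPQ : ∃ i, Q i = P
  · obtain ⟨j, rfl⟩ := hPQ
    have := congrFun heq j
    have := h.ord_apply j
    omega
  · push Not at hPQ
    have := h.ord_eq_zero hPQ
    omega

theorem IsMinimalVProduct.irreducible (h : IsMinimalVProduct x Q e)
    (hnt : ∀ i, (Q i).IsNontorsion) (i : Fin n) : Irreducible x := by
  have := (Q i).isPrime
  refine ⟨fun hu => this.ne_top (Ideal.eq_top_of_isUnit_mem _ (h.mem i) hu), fun a b hab => ?_⟩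
  rcases this.mem_or_mem (hab ▸ h.mem i) with ha | hb
  · exact Or.inr (h.isUnit_of_eq_mul hnt hab ha)
  · exact Or.inl (h.isUnit_of_eq_mul hnt (hab.trans (mul_comm a b)) hb)

theorem IsMinimalVProduct.associated_of_sq_eq_mul (h : IsMinimalVProduct x Q e)
    (hnt : ∀ i, (Q i).IsNontorsion) {a b : R} (hab : x ^ 2 = a * b) (hirr : Irreducible a)
    {i : Fin n} (ha : a ∈ (Q i).asIdeal) : Associated a x ∧ Associated b x := by
  have hx2 := pow_ne_zero 2 h.ne_zero
  have ha0 : a ≠ 0 := hirr.ne_zero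
  have hb0 : b ≠ 0 := right_ne_zero_of_mul (hab ▸ hx2)
  have hord : ∀ P : HeightOnePrime R, 2 * P.ord x = P.ord a + P.ord b := fun P => by
    rw [← P.ord_pow h.ne_zero, hab, P.ord_mul ha0 hb0]
  have hae : ∀ P : HeightOnePrime R, (∀ i, Q i ≠ P) → P.ord a = 0 := fun P hP => by
    have := h.ord_eq_zero hP
    have := hord P
    omega
  have hbe : ∀ P : HeightOnePrime R, (∀ i, Q i ≠ P) → P.ord b = 0 := fun P hP => by
    have := h.ord_eq_zero hP
    have := hord P
    omega
  by_cases hb : ∃ j, b ∈ (Q j).asIdeal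
  · have hsum : toLex e + toLex e =
        toLex (fun i => (Q i).ord a) + toLex fun i => (Q i).ord b := by
      rw [← toLex_add, ← toLex_add]
      congr 1
      funext j
      have := hord (Q j)
      rw [h.ord_apply] at this
      simp only [Pi.add_apply]
      omega
    -- Addition is strictly monotone for the lexicographic order, so two tuples at least `e` with
    -- sum `e + e` both equal `e`.
    obtain ⟨hea, heb⟩ := (add_eq_add_iff_eq_and_eq (h.lex_le_ord hnt ha0 hae ⟨i, ha⟩)
      (h.lex_le_ord hnt hb0 hbe hb)).1 hsum
    have key : ∀ {c : R}, c ≠ 0 → (∀ P : HeightOnePrime R, (∀ i, Q i ≠ P) → P.ord c = 0) →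
        toLex e = toLex (fun i => (Q i).ord c) → Associated c x := by
      intro c hc0 hce hc
      refine associated_of_forall_ord_eq hc0 h.ne_zero fun P => ?_
      by_cases hPQ : ∃ i, Q i = P
      · obtain ⟨j, rfl⟩ := hPQ
        rw [h.ord_apply]
        exact (congrFun (toLex.injective hc) j).symm
      · push Not at hPQ
        rw [hce P hPQ, h.ord_eq_zero hPQ]
    exact ⟨key ha0 hae hea, key hb0 hbe heb⟩
  · push Not at hb
    -- With `b` outside every `Q j`, it is a unit, and irreducibility of `a` would make `x ^ 2`
    -- irreducible.
    have hbu : IsUnit b := by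
      refine isUnit_of_forall_ord_eq_zero hb0 fun P => ?_
      by_cases hPQ : ∃ i, Q i = P
      · obtain ⟨j, rfl⟩ := hPQ
        exact ((Q j).ord_eq_zero_iff hb0).2 (hb j)
      · push Not at hPQ
        exact hbe P hPQ
    have hx := h.irreducible hnt i
    have h2 : Irreducible (x ^ 2) := by
      rw [hab, irreducible_mul_isUnit hbu]
      exact hirr
    rw [pow_two] at h2
    exact absurd (h2.isUnit_or_isUnit rfl) (by simp [hx.not_isUnit])

/-- As `Q i` is prime, every factorization of `x ^ 2` has a factor in it. The product of the
remaining factors is associated to `x`, hence irreducible, hence a single factor. -/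
theorem IsMinimalVProduct.factorsUniquely_sq (h : IsMinimalVProduct x Q e)
    (hnt : ∀ i, (Q i).IsNontorsion) (i : Fin n) : FactorsUniquely (x ^ 2) := by
  have hprime := (Q i).isPrime
  have hx := h.irreducible hnt i
  have key : ∀ s : Multiset R, (∀ a ∈ s, Irreducible a) → s.prod = x ^ 2 →
      ∃ a b, s = {a, b} ∧ Associated a x ∧ Associated b x := by
    intro s hs hprod
    have hmem : s.prod ∈ (Q i).asIdeal :=
      hprod ▸ Ideal.pow_mem_of_mem _ (h.mem i) 2 two_pos
    obtain ⟨a, has, ha⟩ := (hprime.multiset_prod_mem_iff_exists_mem s).1 hmem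
    obtain ⟨t, rfl⟩ := Multiset.exists_cons_of_mem has
    rw [Multiset.prod_cons] at hprod
    obtain ⟨hax, hbx⟩ := h.associated_of_sq_eq_mul hnt hprod.symm (hs a has) ha
    obtain ⟨b, rfl⟩ := exists_eq_singleton_of_irreducible_prod
      (fun c hc => hs c (Multiset.mem_cons_of_mem hc)) (hbx.symm.irreducible hx)
    exact ⟨a, b, rfl, hax, by simpa using hbx⟩
  refine ⟨pow_ne_zero 2 h.ne_zero, fun hu => hx.not_isUnit ((isUnit_pow_iff two_ne_zero).1 hu),
    fun s t hs ht hsx htx => ?_⟩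
  obtain ⟨a, b, rfl, ha, hb⟩ := key s hs hsx
  obtain ⟨c, d, rfl, hc, hd⟩ := key t ht htx
  exact .cons (ha.trans hc.symm) (.cons (hb.trans hd.symm) .zero)

end MinimalVProduct

end KrullFactorization
theorem mainTheorem7 (R : Type*) [CommRing R] [IsDomain R] [KrullFactorization.IsKrullDomain R]
    (hR : ¬ IsMulTorsion (KrullFactorization.DivisorClassGroup R)) :
    ∃ (P : KrullFactorization.HeightOnePrime R) (x : R),
      P.IsNontorsion ∧ Irreducible x ∧ x ∈ P.asIdeal ∧
      KrullFactorization.FactorsUniquely (x ^ 2) ∧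
      ∃ (n : ℕ) (Q : Fin n → KrullFactorization.HeightOnePrime R) (e : Fin n → ℕ),
        (∃ i, Q i = P) ∧ KrullFactorization.IsMinimalVProduct x Q e := by
  obtain ⟨x, n, Q, e, h, hnt, hn⟩ := KrullFactorization.exists_isMinimalVProduct hR
  exact ⟨Q ⟨0, hn⟩, x, hnt _, h.irreducible hnt ⟨0, hn⟩, h.mem _,
    h.factorsUniquely_sq hnt ⟨0, hn⟩, n, Q, e, ⟨_, rfl⟩, h⟩
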